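/- Let $[n]=\{1,\dots,n\}$ and $1\le k\le n$. The packet of a finite set $X=\{x_1<\dots<x_m\}\subseteq[n]$ is $P(X)=\{X\setminus\{x_i\} : 1\le i\le m\}$; its lexicographic order is $(X\setminus\{x_m\},X\setminus\{x_{m-1}\},\dots,X\setminus\{x_1\})$. A total order $\rho$ on the set $\binom{[n]}{k}$ of $k$-element subsets of $[n]$ is admissible if for every $X\in\binom{[n]}{k+1}$ the restriction of $\rho$ to $P(X)$ is either the lexicographic order or its reverse. Two admissible orders are commutation equivalent if one is obtained from the other by a finite sequence of transpositions of two adjacent entries $X,Y\in\binom{[n]}{k}$ with $P(X)\cap P(Y)=\varnothing$. The elements of the higher Bruhat order $B(n,k)$ are the commutation equivalence classes of admissible orders on $\binom{[n]}{k}$. **Theorem.** For every integer $n\ge 4$, $$|B(n,n-3)| = 2^n + n\,2^{n-2} - 2n .$$ -/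

import Mathlib

namespace HigherBruhat

/-- The packet `P(X)`: the set of all `X \ {x}` with `x ∈ X`. -/
def packet {n : ℕ} (X : Finset (Fin n)) : Finset (Finset (Fin n)) :=
  X.image fun x => X.erase x

/-- The packet of `X = {x₁ < ⋯ < xₘ}` listed in lexicographic order, that is
`(X \ {xₘ}, X \ {xₘ₋₁}, …, X \ {x₁})`. -/
def lexPacket {n : ℕ} (X : Finset (Fin n)) : List (Finset (Fin n)) :=
  (X.sort (· ≤ ·)).reverse.map fun x => X.erase x

/-- A total order on the `k`-element subsets of `Fin n`, written as the sequence of all these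
subsets, each listed exactly once. -/
def IsTotalOrder {n : ℕ} (k : ℕ) (ρ : List (Finset (Fin n))) : Prop :=
  ρ.Nodup ∧ ∀ S : Finset (Fin n), S ∈ ρ ↔ S.card = k

/-- The restriction of the sequence `ρ` to the packet of `X`. -/
def restrict {n : ℕ} (ρ : List (Finset (Fin n))) (X : Finset (Fin n)) :
    List (Finset (Fin n)) :=
  ρ.filter fun S => S ∈ packet X

/-- A total order on the `k`-element subsets is admissible if its restriction to the packet of
every `(k+1)`-element subset is the lexicographic order or its reverse. -/
def IsAdmissible {n : ℕ} (k : ℕ) (ρ : List (Finset (Fin n))) : Prop :=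
  IsTotalOrder k ρ ∧
    ∀ X : Finset (Fin n), X.card = k + 1 →
      restrict ρ X = lexPacket X ∨ restrict ρ X = (lexPacket X).reverse

/-- The set `A(n, k)` of admissible orders on the `k`-element subsets of an `n`-element chain. -/
def AdmissibleOrder (n k : ℕ) : Type :=
  {ρ : List (Finset (Fin n)) // IsAdmissible k ρ}

/-- `ρ'` arises from `ρ` by one commutation: transposing two neighbouring entries `X`, `Y` with
disjoint packets. -/
def Commutation {n k : ℕ} (ρ ρ' : AdmissibleOrder n k) : Prop :=
  ∃ (l r : List (Finset (Fin n))) (X Y : Finset (Fin n)),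
    Disjoint (packet X) (packet Y) ∧ ρ.1 = l ++ X :: Y :: r ∧ ρ'.1 = l ++ Y :: X :: r

/-- Commutation equivalence: one order is reached from the other by a sequence of commutations. -/
def commutationSetoid (n k : ℕ) : Setoid (AdmissibleOrder n k) :=
  Relation.EqvGen.setoid Commutation

/-- The elements of the higher Bruhat order `B(n, k)`: the commutation classes of admissible
orders on the `k`-element subsets of an `n`-element chain. -/
def B (n k : ℕ) : Type :=
  Quotient (commutationSetoid n k)

end HigherBruhat

namespace HigherBruhat

open Set

/-! A commutation class is determined by its inversion set, the family of (k+1)-sets whose packets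
occur in reverse order. For k = n-3, taking complements turns this family into a graph on n
vertices. Transitivity of the order forces the adjacency row of every vertex i (over the other
vertices, in increasing order) to change value at most once (`IsAdmissible.inverted_row`).
Conversely, every such graph arises from an order: `IsConsistentOn.exists_rank` builds a ranking of
all subsets at once, and sorting the k-sets by the rank of their complements gives an admissible
order. So the task is to count `consistent n`.

Delete the last vertex m = n-1. Its row is a step sequence: s before p and !s from p on, with p < m.
Each remaining row must still change at most once when its entry at m is appended, so once an entry
takes that final value, so do all later ones. If p = 0 there are 2^(m-1) such graphs. If p > 0, the
entry at (p-1, p) separates two cases. If it is s, all entries across the break are s and the two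
sides are independent, giving 2^(m-2) graphs. If it is !s, both sides are constant and the entries
across form a monotone box filling other than the constant s, giving C(m,p) - 1. Summing over p and
the two values of s gives the formula. -/

/-- If the values of `c ∈ S` on the region `Q` are prescribed by `g`, then erasing them is a
bijection onto `T`. -/
theorem ncard_eq_of_forced {S T : Set (ℕ → ℕ → Bool)} (Q : ℕ → ℕ → Prop) [∀ i j, Decidable (Q i j)]
    (g : ℕ → ℕ → Bool)
    (hST : ∀ c ∈ S, (fun i j => if Q i j then false else c i j) ∈ T)
    (hTS : ∀ c ∈ T, (fun i j => if Q i j then g i j else c i j) ∈ S)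
    (hS : ∀ c ∈ S, ∀ i j, Q i j → c i j = g i j)
    (hT : ∀ c ∈ T, ∀ i j, Q i j → c i j = false) : S.ncard = T.ncard := by
  refine Set.ncard_congr (fun c _ i j => if Q i j then false else c i j) hST ?_ ?_
  · intro c d hc hd h
    funext i j
    have := congrFun (congrFun h i) j
    have h1 := hS c hc i j
    have h2 := hS d hd i j
    by_cases hq : Q i j <;> simp_all
  · intro c hc
    refine ⟨_, hTS c hc, ?_⟩
    funext i j
    have := hT c hc i j
    by_cases hq : Q i j <;> simp_all

theorem finite_of_support {S : Set (ℕ → ℕ → Bool)} (n : ℕ)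
    (h : ∀ c ∈ S, ∀ i j, c i j = true → i < n ∧ j < n) : S.Finite := by
  have : Function.Injective
      (fun (c : S) (p : Fin n × Fin n) => c.1 p.1 p.2) := by
    intro c d hcd
    ext i j
    by_cases hij : i < n ∧ j < n
    · simpa using congrFun hcd (⟨i, hij.1⟩, ⟨j, hij.2⟩)
    · have h1 := mt (h c.1 c.2 i j) hij
      have h2 := mt (h d.1 d.2 i j) hij
      simp_all
  have := Finite.of_injective _ this
  exact Set.toFinite S

theorem ncard_split {S : Set (ℕ → ℕ → Bool)} (hS : S.Finite) (t : Bool) (x y : ℕ) :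
    S.ncard = {c ∈ S | c x y = t}.ncard + {c ∈ S | c x y = !t}.ncard := by
  rw [← Set.ncard_inter_add_ncard_sdiff_eq_ncard S {c | c x y = t} hS]
  congr 2
  ext c
  cases t <;> simp

/-! ### Shifted graphs and monotone box fillings -/

/-- Graphs on `[a, b)` in which the neighbours of each vertex (or, for `t = false`, the
non-neighbours) form a final segment. -/
def shifted (t : Bool) (a b : ℕ) : Set (ℕ → ℕ → Bool) :=
  {c | (∀ i j, c i j = true → a ≤ i ∧ i < j ∧ j < b) ∧
    ∀ i j k, a ≤ i → i < j → j < k → k < b →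
      (c i j = t → c i k = t) ∧ (c i k = t → c j k = t)}

theorem shifted_finite (t : Bool) (a b : ℕ) : (shifted t a b).Finite :=
  finite_of_support b fun c hc i j h => by have := hc.1 i j h; omega

/-- The entry joining the first and last vertices decides which vertex to delete. If it is t, the
whole last column is t; otherwise the whole first row is !t. Either way one vertex carries no
further information. -/
theorem ncard_shifted (t : Bool) (m : ℕ) : ∀ a, (shifted t a (a + m + 1)).ncard = 2 ^ m := by
  induction m with
  | zero =>
    intro a
    rw [pow_zero, Set.ncard_eq_one]
    refine ⟨fun _ _ => false, ?_⟩
    ext c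
    simp only [shifted, Set.mem_ofPred_eq, Set.mem_singleton_iff]
    constructor
    · intro h
      funext i j
      by_contra hc
      have := h.1 i j (by simpa using hc)
      omega
    · rintro rfl
      refine ⟨by simp, ?_⟩
      intros; omega
  | succ m ih =>
    intro a
    rw [ncard_split (shifted_finite _ _ _) t a (a + m + 1), pow_succ, mul_two]
    congr 1
    · rw [← ih a]
      refine ncard_eq_of_forced (fun i j => a ≤ i ∧ i < j ∧ j = a + m + 1) (fun _ _ => t) ?_ ?_ ?_ ?_
      · rintro c ⟨⟨h1, h2⟩, h3⟩
        refine ⟨?_, ?_⟩ <;> grind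
      · rintro c ⟨h1, h2⟩
        refine ⟨⟨?_, ?_⟩, ?_⟩ <;> grind
      · rintro c ⟨⟨h1, h2⟩, h3⟩
        cases t <;> grind
      · rintro c ⟨h1, h2⟩
        grind
    · rw [← ih (a + 1)]
      refine ncard_eq_of_forced (fun i j => i = a ∧ i < j ∧ j < a + m + 2) (fun _ _ => !t)
        ?_ ?_ ?_ ?_
      · rintro c ⟨⟨h1, h2⟩, h3⟩
        refine ⟨?_, ?_⟩ <;> grind
      · rintro c ⟨h1, h2⟩
        refine ⟨⟨?_, ?_⟩, ?_⟩ <;> grind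
      · rintro c ⟨⟨h1, h2⟩, h3⟩
        cases t <;> grind
      · rintro c ⟨h1, h2⟩
        grind

/-- Monotone Boolean fillings of the box `[a, a') × [b, b')`. -/
def boxes (t : Bool) (a a' b b' : ℕ) : Set (ℕ → ℕ → Bool) :=
  {c | (∀ i j, c i j = true → a ≤ i ∧ i < a' ∧ b ≤ j ∧ j < b') ∧
    (∀ i j k, a ≤ i → i < j → j < a' → b ≤ k → k < b' → c i k = t → c j k = t) ∧
    (∀ i k l, a ≤ i → i < a' → b ≤ k → k < l → l < b' → c i l = t → c i k = t)}

theorem boxes_finite (t : Bool) (a a' b b' : ℕ) : (boxes t a a' b b').Finite :=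
  finite_of_support (a' + b') fun c hc i j h => by have := hc.1 i j h; omega

theorem ncard_boxes_of_empty (t : Bool) (a a' b b' : ℕ) (h : a' ≤ a ∨ b' ≤ b) :
    (boxes t a a' b b').ncard = 1 := by
  rw [Set.ncard_eq_one]
  refine ⟨fun _ _ => false, ?_⟩
  ext c
  simp only [boxes, Set.mem_ofPred_eq, Set.mem_singleton_iff]
  constructor
  · intro h
    funext i j
    by_contra hc
    have := h.1 i j (by simpa using hc)
    omega
  · rintro rfl
    refine ⟨by simp, ?_, ?_⟩ <;> intros <;> omega

/-- Pascal's rule: if the corner (a, b) is t, the column b is all t; otherwise the row a is all !t.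
-/
theorem ncard_boxes (t : Bool) (x y : ℕ) :
    ∀ a b, (boxes t a (a + x) b (b + y)).ncard = (x + y).choose x := by
  induction x generalizing y with
  | zero => intro a b; rw [ncard_boxes_of_empty _ _ _ _ _ (by omega)]; simp
  | succ x ihx =>
    induction y with
    | zero => intro a b; rw [ncard_boxes_of_empty _ _ _ _ _ (by omega)]; simp
    | succ y ihy =>
      intro a b
      rw [ncard_split (boxes_finite _ _ _ _ _) t a b,
        show x + 1 + (y + 1) = x + 1 + y + 1 by ring, Nat.choose_succ_succ, add_comm]
      congr 1
      · rw [show x + 1 + y = x + (y + 1) by ring, ← ihx (y + 1) (a + 1) b]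
        refine ncard_eq_of_forced (fun i j => i = a ∧ b ≤ j ∧ j < b + y + 1) (fun _ _ => !t)
          ?_ ?_ ?_ ?_
        · rintro c ⟨⟨h1, h2, h4⟩, h3⟩
          refine ⟨?_, ?_, ?_⟩ <;> grind
        · rintro c ⟨h1, h2, h4⟩
          refine ⟨⟨?_, ?_, ?_⟩, ?_⟩ <;> grind
        · rintro c ⟨⟨h1, h2, h4⟩, h3⟩
          cases t <;> grind
        · rintro c ⟨h1, h2, h4⟩
          grind
      · rw [← ihy a (b + 1)]
        refine ncard_eq_of_forced (fun i j => a ≤ i ∧ i < a + x + 1 ∧ j = b) (fun _ _ => t)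
          ?_ ?_ ?_ ?_
        · rintro c ⟨⟨h1, h2, h4⟩, h3⟩
          refine ⟨?_, ?_, ?_⟩ <;> grind
        · rintro c ⟨h1, h2, h4⟩
          refine ⟨⟨?_, ?_, ?_⟩, ?_⟩ <;> grind
        · rintro c ⟨⟨h1, h2, h4⟩, h3⟩
          cases t <;> grind
        · rintro c ⟨h1, h2, h4⟩
          grind

/-! ### Graphs compatible with a prescribed last row -/

/-- The sign sequence of length `m` that equals `s` before `p` and `!s` from `p` on. -/
def step (s : Bool) (p i : ℕ) : Bool := if i < p then s else !s

/-- Graphs on `[0, m)` in which the row of each vertex `i`, followed by the value `step s p i`,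
changes at most once. -/
def extendable (s : Bool) (p m : ℕ) : Set (ℕ → ℕ → Bool) :=
  {c | (∀ i j, c i j = true → i < j ∧ j < m) ∧
    ∀ i j k, i < j → j < k → k < m →
      (c i j = step s p i → c i k = step s p i) ∧
      (c i j = step s p j → c j k = step s p j) ∧
      (c i k = step s p k → c j k = step s p k)}

/-- Graphs on `[0, n)` in which the row of each vertex changes at most once. -/
def consistent (n : ℕ) : Set (ℕ → ℕ → Bool) :=
  {c | (∀ i j, c i j = true → i < j ∧ j < n) ∧
    ∀ i j k l, i < j → j < k → k < l → l < n →
      (c i j = c i l → c i k = c i j) ∧ (c i j = c j l → c j k = c i j) ∧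
      (c i k = c k l → c j k = c i k) ∧ (c i l = c k l → c j l = c i l)}

theorem extendable_finite (s : Bool) (p m : ℕ) : (extendable s p m).Finite :=
  finite_of_support m fun c hc i j h => by have := hc.1 i j h; omega

theorem extendable_zero (s : Bool) (m : ℕ) : extendable s 0 m = shifted (!s) 0 m := by
  ext c
  simp only [extendable, shifted, step, Set.mem_ofPred_eq, Nat.not_lt_zero, if_false]
  constructor
  · rintro ⟨h1, h2⟩
    refine ⟨fun i j h => ⟨by omega, h1 i j h⟩, fun i j k _ h h' h'' => ?_⟩
    have := h2 i j k h h' h''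
    tauto
  · rintro ⟨h1, h2⟩
    refine ⟨fun i j h => (h1 i j h).2, fun i j k h h' h'' => ?_⟩
    have := h2 i j k (by omega) h h' h''
    tauto

/-- Here the graph splits into two independent shifted graphs, one on each side of the break. -/
theorem ncard_extendable_eq (s : Bool) (x y : ℕ) :
    {c ∈ extendable s (x + 1) (x + 1 + (y + 1)) | c x (x + 1) = s}.ncard = 2 ^ (x + y) := by
  have key : (shifted s 0 (0 + x + 1) ×ˢ shifted (!s) (x + 1) (x + 1 + y + 1)).ncard =
      2 ^ (x + y) := by
    rw [Set.ncard_prod, ncard_shifted, ncard_shifted, pow_add]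
  rw [← key, zero_add]
  clear key
  -- The value s spreads up column x+1, whose final value is !s, and then along each row i ≤ x,
  -- whose final value is s.
  have hcross : ∀ c ∈ extendable s (x + 1) (x + 1 + (y + 1)), c x (x + 1) = s →
      ∀ i j, i < x + 1 → x + 1 ≤ j → j < x + 1 + (y + 1) → c i j = s := by
    rintro c ⟨h1, h2⟩ h i j hi hj hj'
    have h3 : c i (x + 1) = s := by
      rcases Nat.lt_or_ge i x with hix | hix
      · have := h2 i x (x + 1) hix (by omega) (by omega)
        cases s <;> grind [step]
      · grind
    rcases Nat.lt_or_ge (x + 1) j with hxj | hxj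
    · have := h2 i (x + 1) j (by omega) hxj hj'
      cases s <;> grind [step]
    · grind
  refine Set.ncard_congr (fun c _ => (fun i j => if j < x + 1 then c i j else false,
    fun i j => if x + 1 ≤ i then c i j else false)) ?_ ?_ ?_
  · rintro c ⟨hc, h⟩
    obtain ⟨h1, h2⟩ := hc
    refine ⟨⟨?_, ?_⟩, ?_, ?_⟩
    · intro i j hcij
      have := h1 i j
      clear h2 hcross
      dsimp only at hcij
      split_ifs at hcij
      grind
    · intro i j k _ hij hjk hk
      have := h2 i j k hij hjk (by omega)
      clear h1 h2 hcross
      cases s <;> grind [step]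
    · intro i j hcij
      have := h1 i j
      clear h2 hcross
      dsimp only at hcij
      split_ifs at hcij
      grind
    · intro i j k _ hij hjk hk
      have := h2 i j k hij hjk (by omega)
      clear h1 h2 hcross
      cases s <;> grind [step]
  · rintro c d ⟨hc, h⟩ ⟨hd, h'⟩ hcd
    have hc' := hcross c hc h
    have hd' := hcross d hd h'
    have hc1 := hc.1
    have hd1 := hd.1
    rw [Prod.mk.injEq] at hcd
    funext i j
    have e1 := congrFun (congrFun hcd.1 i) j
    have e2 := congrFun (congrFun hcd.2 i) j
    by_cases hj : j < x + 1
    · grind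
    by_cases hi : x + 1 ≤ i
    · grind
    by_cases hj' : j < x + 1 + (y + 1)
    · rw [hc' i j (by omega) (by omega) hj', hd' i j (by omega) (by omega) hj']
    · have := mt (hc1 i j) (by omega)
      have := mt (hd1 i j) (by omega)
      simp_all
  · rintro ⟨c, d⟩ ⟨⟨hc1, hc2⟩, ⟨hd1, hd2⟩⟩
    dsimp only at hc1 hc2 hd1 hd2
    refine ⟨fun i j => if j < x + 1 then c i j else if x + 1 ≤ i then d i j else
      if j < x + 1 + (y + 1) then s else false, ⟨⟨?_, ?_⟩, ?_⟩, ?_⟩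
    · intro i j
      have := hc1 i j
      have := hd1 i j
      clear hc1 hd1 hc2 hd2 hcross
      grind
    · intro i j k hij hjk hk
      by_cases hk' : k < x + 1
      · have := hc2 i j k (by omega) hij hjk hk'
        clear hc1 hd1 hc2 hd2 hcross
        have : step s (x + 1) i = s ∧ step s (x + 1) j = s ∧ step s (x + 1) k = s := by
          grind [step]
        cases s <;> grind
      by_cases hi' : x + 1 ≤ i
      · have := hd2 i j k (by omega) hij hjk hk
        clear hc1 hd1 hc2 hd2 hcross
        have : step s (x + 1) i = !s ∧ step s (x + 1) j = !s ∧ step s (x + 1) k = !s := by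
          grind [step]
        cases s <;> grind
      clear hc1 hd1 hc2 hd2 hcross
      cases s <;> grind [step]
    · simp
    · rw [Prod.mk.injEq]
      constructor <;> funext i j <;> have := hc1 i j <;> have := hd1 i j <;>
        clear hc1 hd1 hc2 hd2 hcross <;> grind

/-- An entry s within the left side, or within the right side, would contradict the value !s at (x,
x+1). Only the entries across the break remain free. -/
theorem ncard_extendable_ne (s : Bool) (x y : ℕ) :
    {c ∈ extendable s (x + 1) (x + 1 + (y + 1)) | c x (x + 1) = !s}.ncard =
      (x + 1 + (y + 1)).choose (x + 1) - 1 := by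
  have hbox := ncard_boxes (!s) (x + 1) (y + 1) 0 (x + 1)
  rw [zero_add, ncard_split (boxes_finite _ _ _ _ _) (!s) x (x + 1)] at hbox
  -- (x, x+1) is the corner where !s appears first in a monotone filling, so the value s there
  -- forces the constant filling.
  have hone : {c ∈ boxes (!s) 0 (x + 1) (x + 1) (x + 1 + (y + 1)) | c x (x + 1) = !!s}.ncard
      = 1 := by
    rw [Set.ncard_eq_one]
    refine ⟨fun i j => if i < x + 1 ∧ x + 1 ≤ j ∧ j < x + 1 + (y + 1) then s else false, ?_⟩
    ext c
    simp only [boxes, Set.mem_ofPred_eq, Set.mem_singleton_iff, Bool.not_not]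
    constructor
    · rintro ⟨⟨h1, h2, h3⟩, h4⟩
      funext i j
      have a1 := h1 i j
      have a2 := h2 i x j
      have a3 := h3 x (x + 1) j
      cases s <;> grind
    · rintro rfl
      refine ⟨⟨?_, ?_, ?_⟩, ?_⟩ <;> cases s <;> grind
  rw [hone] at hbox
  rw [← hbox, Nat.add_sub_cancel]
  refine ncard_eq_of_forced (fun i j => i < j ∧ j < x + 1 + (y + 1) ∧ (j < x + 1 ∨ x + 1 ≤ i))
    (fun _ _ => !s) ?_ ?_ ?_ ?_
  · rintro c ⟨⟨h1, h2⟩, h⟩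
    refine ⟨⟨?_, ?_, ?_⟩, ?_⟩
    · intro i j
      have := h1 i j
      clear h1 h2 hone hbox
      grind
    · intro i j k _ hij hj hk hk'
      have := h2 i j k hij (by omega) (by omega)
      clear h1 h2 hone hbox
      cases s <;> grind [step]
    · intro i k l _ hi hk hkl hl
      have := h2 i k l (by omega) hkl hl
      clear h1 h2 hone hbox
      cases s <;> grind [step]
    · clear h1 h2 hone hbox
      grind
  · rintro c ⟨⟨h1, h2, h3⟩, h4⟩
    refine ⟨⟨?_, ?_⟩, ?_⟩
    · intro i j
      have := h1 i j
      clear h1 h2 h3 hone hbox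
      grind
    · intro i j k hij hjk hk
      have := h2 i j k (by omega) hij
      have := h3 i j k (by omega)
      clear h1 h2 h3 hone hbox
      cases s <;> grind [step]
    · clear h1 h2 h3 hone hbox
      grind
  · rintro c ⟨⟨h1, h2⟩, h⟩ i j ⟨hij, hj, hq⟩
    have a1 := h2 i j (x + 1)
    have a2 := h2 i x (x + 1)
    have a3 := h2 x (x + 1) j
    have a4 := h2 x (x + 1) j
    have a6 := h2 (x + 1) i j
    have a5 := h2 i j x
    clear h1 h2 hone hbox
    cases s <;> grind [step]
  · rintro c ⟨⟨h1, h2, h3⟩, h4⟩ i j hq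
    have := h1 i j
    clear h1 h2 h3 hone hbox
    grind

theorem ncard_extendable_zero (s : Bool) (k : ℕ) : (extendable s 0 (k + 2)).ncard = 2 ^ (k + 1) := by
  rw [extendable_zero, show k + 2 = 0 + (k + 1) + 1 by ring, ncard_shifted]

theorem ncard_extendable_succ (s : Bool) (q k : ℕ) (hq : q < k + 1) :
    ((extendable s (q + 1) (k + 2)).ncard : ℤ) = 2 ^ k + ((k + 2).choose (q + 1) : ℤ) - 1 := by
  obtain ⟨y, rfl⟩ : ∃ y, k = q + y := ⟨k - q, by omega⟩
  have h1 := ncard_extendable_eq s q y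
  have h2 := ncard_extendable_ne s q y
  rw [show q + 1 + (y + 1) = q + y + 2 by ring] at h1 h2
  have h3 : 1 ≤ (q + y + 2).choose (q + 1) := Nat.choose_pos (by omega)
  rw [ncard_split (extendable_finite _ _ _) s q (q + 1), h1, h2]
  push_cast [h3]
  ring

/-! ### Deleting the last vertex -/

theorem exists_step {v : ℕ → Bool} {m : ℕ} (hm : 0 < m)
    (hv : ∀ i j k, i < j → j < k → k < m → v i = v k → v j = v i) :
    ∃ s, ∃ p < m, ∀ i < m, v i = step s p i := by
  classical
  have hex : ∃ i, v i = v (m - 1) := ⟨_, rfl⟩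
  -- The break is the first index that carries the last value. Hence p < m, and a constant sequence
  -- gets p = 0; this makes (s, p) unique.
  refine ⟨!v (m - 1), Nat.find hex, ?_, ?_⟩
  · have := Nat.find_min' hex (m := m - 1) rfl
    omega
  · intro i hi
    have h1 := Nat.find_spec hex
    by_cases hip : i < Nat.find hex
    · have := Nat.find_min hex hip
      simp only [step, if_pos hip]
      revert this
      cases v i <;> cases v (m - 1) <;> simp
    · simp only [step, if_neg hip, Bool.not_not]
      have h3 := hv (Nat.find hex) i (m - 1)
      grind

theorem step_injective {s s' : Bool} {p p' m : ℕ} (hp : p < m) (hp' : p' < m)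
    (h : ∀ i < m, step s p i = step s' p' i) : s = s' ∧ p = p' := by
  have h1 := h (m - 1) (by omega)
  have h2 := h p hp
  have h3 := h p' hp'
  simp only [step] at h1 h2 h3
  rw [if_neg (by omega), if_neg (by omega)] at h1
  grind

theorem consistent_finite (n : ℕ) : (consistent n).Finite :=
  finite_of_support n fun c hc i j h => by have := hc.1 i j h; omega

theorem ncard_consistent_fiber (s : Bool) (p m : ℕ) :
    {c ∈ consistent (m + 1) | ∀ i < m, c i m = step s p i}.ncard = (extendable s p m).ncard := by
  refine ncard_eq_of_forced (fun i j => i < m ∧ j = m) (fun i _ => step s p i) ?_ ?_ ?_ ?_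
  · rintro c ⟨⟨h1, h2⟩, h⟩
    refine ⟨?_, ?_⟩
    · intro i j
      have := h1 i j
      clear h1 h2
      grind
    · intro i j k hij hjk hk
      have h3 := h2 i j k m hij hjk hk (by omega)
      rw [h i (by omega), h j (by omega), h k (by omega)] at h3
      clear h1 h2 h
      beta_reduce
      rw [if_neg (by omega), if_neg (by omega), if_neg (by omega)]
      grind
  · rintro c ⟨h1, h2⟩
    refine ⟨⟨?_, ?_⟩, ?_⟩
    · intro i j
      have := h1 i j
      clear h1 h2
      grind
    · intro i j k l hij hjk hkl hl
      by_cases hlm : l = m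
      · subst hlm
        have h3 := h2 i j k hij hjk hkl
        clear h1 h2
        have : step s p i = step s p k → step s p j = step s p i := by grind [step]
        grind
      · have h3 := h2 i j k hij hjk (by omega)
        have h4 := h2 i k l (by omega) hkl (by omega)
        have h5 := h2 i j l hij (by omega) (by omega)
        have h6 := h2 j k l hjk hkl (by omega)
        clear h1 h2
        beta_reduce
        rw [if_neg (by omega), if_neg (by omega), if_neg (by omega), if_neg (by omega),
          if_neg (by omega), if_neg (by omega)]
        -- A row that keeps the value v once it has taken it changes at most once.
        have row : ∀ a b d v : Bool, (a = v → b = v) → (b = v → d = v) → a = d → b = a := by decide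
        exact ⟨row _ _ _ _ h3.1 h4.1, row _ _ _ _ h3.2.1 h6.1, row _ _ _ _ h3.2.2 h6.2.1,
          row _ _ _ _ h5.2.2 h6.2.2⟩
    · intro i hi
      simp [hi]
  · rintro c ⟨_, h⟩ i j ⟨hi, rfl⟩
    exact h i hi
  · rintro c ⟨h1, _⟩ i j ⟨hi, rfl⟩
    have := mt (h1 i j) (by omega)
    simpa using this

theorem ncard_consistent_succ (m : ℕ) (hm : 0 < m) :
    (consistent (m + 1)).ncard = ∑ x : Bool × Fin m, (extendable x.1 x.2 m).ncard := by
  have hU : consistent (m + 1) =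
      ⋃ x : Bool × Fin m, {c ∈ consistent (m + 1) | ∀ i < m, c i m = step x.1 x.2 i} := by
    ext c
    simp only [Set.mem_iUnion, Set.mem_ofPred_eq]
    constructor
    · intro hc
      obtain ⟨s, p, hp, h⟩ := exists_step (v := fun i => c i m) hm fun i j k hij hjk hk h =>
        (hc.2 i j k m hij hjk hk (by omega)).2.2.2 h
      exact ⟨(s, ⟨p, hp⟩), hc, h⟩
    · rintro ⟨_, hc, _⟩
      exact hc
  rw [hU, Set.ncard_iUnion_of_finite, finsum_eq_sum_of_fintype]
  · exact Finset.sum_congr rfl fun x _ => ncard_consistent_fiber _ _ _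
  · exact fun x => (consistent_finite _).subset fun c hc => hc.1
  · rintro ⟨s, p⟩ ⟨s', p'⟩ hne
    refine Set.disjoint_left.2 fun c hc hc' => hne ?_
    obtain ⟨rfl, h⟩ := step_injective p.2 p'.2 fun i hi => (hc.2 i hi).symm.trans (hc'.2 i hi)
    rw [Fin.ext h]

theorem ncard_consistent (k : ℕ) :
    ((consistent (k + 3)).ncard : ℤ) = 2 ^ (k + 3) + (k + 3) * 2 ^ (k + 1) - 2 * (k + 3) := by
  have hs : ∀ s : Bool, ∑ p : Fin (k + 2), ((extendable s p (k + 2)).ncard : ℤ) =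
      2 ^ (k + 1) + (k + 1) * (2 ^ k - 1) + (2 ^ (k + 2) - 2) := by
    intro s
    -- The two outer binomial coefficients are missing because p runs from 1 to k+1.
    have hch : ∑ q ∈ Finset.range (k + 1), ((k + 2).choose (q + 1) : ℤ) = 2 ^ (k + 2) - 2 := by
      have h := Nat.sum_range_choose (k + 2)
      rw [Finset.sum_range_succ, Finset.sum_range_succ'] at h
      simp only [Nat.choose_zero_right, Nat.choose_self] at h
      have : ((∑ q ∈ Finset.range (k + 1), (k + 2).choose (q + 1) : ℕ) : ℤ) + 2 = 2 ^ (k + 2) := by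
        exact_mod_cast h
      push_cast at this
      linarith
    rw [Finset.sum_fin_eq_sum_range, Finset.sum_range_succ', dif_pos (by omega),
      ncard_extendable_zero, ← hch]
    have : ∀ q ∈ Finset.range (k + 1), (if h : q + 1 < k + 2 then
        ((extendable s ((⟨q + 1, h⟩ : Fin (k + 2)) : ℕ) (k + 2)).ncard : ℤ) else 0) =
        (2 ^ k - 1) + ((k + 2).choose (q + 1) : ℤ) := by
      intro q hq
      rw [Finset.mem_range] at hq
      rw [dif_pos (by omega), ncard_extendable_succ s q k hq]
      ring
    rw [Finset.sum_congr rfl this, Finset.sum_add_distrib, Finset.sum_const, Finset.card_range]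
    push_cast
    ring
  rw [ncard_consistent_succ (k + 2) (by omega), Fintype.sum_prod_type]
  push_cast
  rw [Finset.sum_congr rfl fun s _ => hs s]
  simp only [Finset.sum_const, Finset.card_univ, Fintype.card_bool]
  ring

/-! ### Realizing consistent colourings by rankings -/

/-- On the subsets of `s`, the colouring `col` changes at most once along the sequence
`insert x A`, where `x` runs through the complement of `A` in increasing order. -/
def IsConsistentOn {α : Type*} [LinearOrder α] (s : Finset α) (col : Finset α → Prop) : Prop :=
  ∀ A ⊆ s, ∀ x ∈ s, ∀ y ∈ s, ∀ z ∈ s, x ∉ A → y ∉ A → z ∉ A → x < y → y < z →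
    (col (insert x A) ↔ col (insert z A)) → (col (insert y A) ↔ col (insert x A))

/-- A consistent colouring is realized by a ranking of the subsets: the ranking increases along
`insert x B` if `B` is coloured, and decreases otherwise. -/
theorem IsConsistentOn.exists_rank {α : Type*} [LinearOrder α] (s : Finset α) :
    ∀ col : Finset α → Prop, IsConsistentOn s col →
      ∃ f : Finset α → ℕ, ∀ B ⊆ s, ∀ x ∈ s, ∀ y ∈ s, x ∉ B → y ∉ B → x < y →
        (col B → f (insert x B) < f (insert y B)) ∧
        (¬ col B → f (insert y B) < f (insert x B)) := by
  classical
  induction s using Finset.induction_on_max with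
  | empty => intro col _; exact ⟨fun _ => 0, by simp⟩
  | insert a s ha ih =>
    intro col hcol
    have has : a ∉ s := fun h => lt_irrefl _ (ha a h)
    have hsub : s ⊆ insert a s := Finset.subset_insert a s
    obtain ⟨f₁, hf₁⟩ := ih col fun A hA x hx y hy z hz =>
      hcol A (hA.trans hsub) x (hsub hx) y (hsub hy) z (hsub hz)
    obtain ⟨f₂, hf₂⟩ := ih (fun B => col (insert a B)) fun A hA x hx y hy z hz hxA hyA hzA hxy hyz => by
      have := hcol (insert a A) (Finset.insert_subset_insert a hA) x (hsub hx) y (hsub hy)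
        z (hsub hz) (by grind) (by grind) (by grind) hxy hyz
      simpa only [Finset.insert_comm a] using this
    obtain ⟨M, hM⟩ : ∃ M, ∀ S ⊆ s, f₁ S < M ∧ f₂ S < M := by
      refine ⟨∑ S ∈ s.powerset, (f₁ S + f₂ S) + 1, fun S hS => ?_⟩
      have := Finset.single_le_sum (f := fun S => f₁ S + f₂ S) (fun _ _ => Nat.zero_le _)
        (Finset.mem_powerset.2 hS)
      omega
    -- Three layers: sets without a lie in [M, 2M), and `insert a A` lies above or below them
    -- according to whether A is coloured. This settles every comparison with y = a.
    refine ⟨fun S => if a ∈ S then (if col (S.erase a) then f₂ (S.erase a) + 2 * M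
      else f₂ (S.erase a)) else f₁ S + M, ?_⟩
    intro B hB x hx y hy hxB hyB hxy
    have hxa : x ≠ a := by
      rintro rfl
      rcases Finset.mem_insert.1 hy with rfl | h
      · exact lt_irrefl _ hxy
      · exact lt_asymm hxy (ha y h)
    have hxs : x ∈ s := (Finset.mem_insert.1 hx).resolve_left hxa
    by_cases haB : a ∈ B
    · obtain ⟨A, haA, rfl⟩ : ∃ A, a ∉ A ∧ B = insert a A :=
        ⟨B.erase a, Finset.notMem_erase a B, (Finset.insert_erase haB).symm⟩
      have hya : y ≠ a := by grind
      have hys : y ∈ s := (Finset.mem_insert.1 hy).resolve_left hya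
      have hAs : A ⊆ s := by grind
      have hxA : x ∉ A := by grind
      have hyA : y ∉ A := by grind
      have ex : (insert x (insert a A)).erase a = insert x A := by grind
      have ey : (insert y (insert a A)).erase a = insert y A := by grind
      have h2 := hf₂ A hAs x hxs y hys hxA hyA hxy
      -- Consistency along x < y < a prevents the layers of the two sets from contradicting the
      -- order given by `f₂`.
      have hc := hcol A (hAs.trans hsub) x hx y hy a (Finset.mem_insert_self a s) hxA hyA haA hxy
        (ha y hys)
      have m1 := hM (insert x A) (Finset.insert_subset hxs hAs)
      have m2 := hM (insert y A) (Finset.insert_subset hys hAs)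
      simp only [Finset.mem_insert, true_or, or_true, if_true, ex, ey]
      constructor
      · intro hca
        have := h2.1 hca
        split_ifs <;> first | omega | tauto
      · intro hca
        have := h2.2 hca
        split_ifs <;> first | omega | tauto
    · have hBs : B ⊆ s := by grind
      have m1 := hM (insert x B) (Finset.insert_subset hxs hBs)
      have hax : a ∉ insert x B := by grind
      by_cases hya : y = a
      · subst hya
        have m2 := hM B hBs
        simp only [Finset.mem_insert_self, if_true, if_neg hax, Finset.erase_insert haB]
        constructor <;> intro hca
        · rw [if_pos hca]; omega
        · rw [if_neg hca]; omega
      · have hys : y ∈ s := (Finset.mem_insert.1 hy).resolve_left hya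
        have hay : a ∉ insert y B := by grind
        have h1 := hf₁ B hBs x hxs y hys hxB hyB hxy
        simp only [if_neg hax, if_neg hay]
        constructor <;> intro hca
        · have := h1.1 hca; omega
        · have := h1.2 hca; omega

/-! ### Reordering lists by adjacent transpositions -/

/-- Transposition of two adjacent entries related by `I`. -/
def AdjSwap {α : Type*} (I : α → α → Prop) (l l' : List α) : Prop :=
  ∃ a b x y, I x y ∧ l = a ++ x :: y :: b ∧ l' = a ++ y :: x :: b

theorem AdjSwap.cons {α : Type*} {I : α → α → Prop} {l l' : List α} (z : α) (h : AdjSwap I l l') :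
    AdjSwap I (z :: l) (z :: l') := by
  obtain ⟨a, b, x, y, hxy, rfl, rfl⟩ := h
  exact ⟨z :: a, b, x, y, hxy, rfl, rfl⟩

theorem reflTransGen_adjSwap_cons {α : Type*} {I : α → α → Prop} {l l' : List α} (z : α)
    (h : Relation.ReflTransGen (AdjSwap I) l l') :
    Relation.ReflTransGen (AdjSwap I) (z :: l) (z :: l') :=
  Relation.ReflTransGen.lift (List.cons z) (fun _ _ => AdjSwap.cons z) _ _ h

theorem reflTransGen_adjSwap_front {α : Type*} {I : α → α → Prop} (x : α) (a b : List α)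
    (h : ∀ y ∈ a, I y x) : Relation.ReflTransGen (AdjSwap I) (a ++ x :: b) (x :: (a ++ b)) := by
  induction a with
  | nil => exact .refl
  | cons y a ih =>
    refine (reflTransGen_adjSwap_cons y (ih fun z hz => h z (List.mem_cons_of_mem _ hz))).tail ?_
    exact ⟨[], a ++ b, y, x, h y List.mem_cons_self, rfl, rfl⟩

/-- Two orderings of the same elements that both respect `R` are connected by transpositions of
adjacent elements not related by `R`. -/
theorem reflTransGen_adjSwap_of_perm {α : Type*} {I R : α → α → Prop}
    (l' : List α) (hI : ∀ x ∈ l', ∀ y ∈ l', x ≠ y → ¬ R x y → ¬ R y x → I x y) :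
    ∀ l : List α, l.Perm l' → l.Nodup → l.Pairwise (fun x y => ¬ R y x) →
      l'.Pairwise (fun x y => ¬ R y x) → Relation.ReflTransGen (AdjSwap I) l l' := by
  induction l' with
  | nil => intro l h _ _ _; rw [h.eq_nil]
  | cons x t ih =>
    intro l hp hn h h'
    obtain ⟨a, b, rfl⟩ := List.append_of_mem (hp.mem_iff.2 List.mem_cons_self)
    have hp' : (a ++ b).Perm t := (List.perm_middle.symm.trans hp).cons_inv
    have hn' := (List.perm_middle.nodup_iff.1 hn)
    rw [List.nodup_cons] at hn'
    rw [List.pairwise_cons] at h'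
    have hsub : (a ++ b).Sublist (a ++ x :: b) :=
      List.Sublist.append_left (List.sublist_cons_self x b) a
    refine (reflTransGen_adjSwap_front x a b fun y hy => ?_).trans
      (reflTransGen_adjSwap_cons x (ih (fun y hy z hz => hI y (List.mem_cons_of_mem _ hy) z
        (List.mem_cons_of_mem _ hz)) _ hp' hn'.2 (h.sublist hsub) h'.2))
    have hya : y ∈ a ++ b := List.mem_append_left b hy
    refine hI y (List.mem_cons_of_mem _ (hp'.mem_iff.1 hya)) x List.mem_cons_self ?_ ?_ ?_
    · rintro rfl
      exact hn'.1 hya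
    · exact h'.1 y (hp'.mem_iff.1 hya)
    · exact (List.pairwise_append.1 h).2.2 y hy x List.mem_cons_self

theorem pairwise_idxOf_lt {α : Type*} [DecidableEq α] {l : List α} (h : l.Nodup) :
    l.Pairwise fun x y => l.idxOf x < l.idxOf y := by
  rw [List.pairwise_iff_getElem]
  intro i j hi hj hij
  rwa [h.idxOf_getElem, h.idxOf_getElem]

theorem idxOf_lt_of_pairwise {α : Type*} [DecidableEq α] {l : List α} {f : α → ℕ}
    (h : l.Pairwise fun x y => f x ≤ f y) {x y : α} (hx : x ∈ l) (hy : y ∈ l) (hxy : f x < f y) :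
    l.idxOf x < l.idxOf y := by
  by_contra hle
  rw [not_lt] at hle
  have hx' := List.idxOf_lt_length_iff.2 hx
  have hy' := List.idxOf_lt_length_iff.2 hy
  rcases hle.lt_or_eq with hlt | heq
  · have := (List.pairwise_iff_getElem.1 h) _ _ hy' hx' hlt
    rw [List.getElem_idxOf, List.getElem_idxOf] at this
    omega
  · rw [List.idxOf_inj hy] at heq
    subst heq
    exact lt_irrefl _ hxy

theorem pairwise_iff_of_pairwise_lt {α : Type*} [LinearOrder α] {l : List α}
    (h : l.Pairwise (· < ·)) (P : α → α → Prop) :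
    l.Pairwise P ↔ ∀ x ∈ l, ∀ y ∈ l, x < y → P x y := by
  refine ⟨fun hP x hx y hy hxy => ?_, fun hP =>
    List.Pairwise.imp_of_mem (fun {a b} ha hb hab => hP a ha b hb hab) h⟩
  induction l with
  | nil => simp at hx
  | cons z l ih =>
    rw [List.pairwise_cons] at h hP
    grind

/-! ### Packets, inversion sets and commutation classes -/

theorem mem_packet {n : ℕ} {X S : Finset (Fin n)} : S ∈ packet X ↔ ∃ x ∈ X, X.erase x = S := by
  simp [packet]

theorem mem_lexPacket {n : ℕ} {X S : Finset (Fin n)} : S ∈ lexPacket X ↔ S ∈ packet X := by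
  simp [lexPacket, packet]

theorem pairwise_lexPacket {n : ℕ} (X : Finset (Fin n))
    (R : Finset (Fin n) → Finset (Fin n) → Prop) :
    (lexPacket X).Pairwise R ↔ ∀ x ∈ X, ∀ y ∈ X, x < y → R (X.erase y) (X.erase x) := by
  rw [lexPacket, List.pairwise_map, List.pairwise_reverse,
    pairwise_iff_of_pairwise_lt X.sortedLT_sort.pairwise]
  simp

theorem pairwise_reverse_lexPacket {n : ℕ} (X : Finset (Fin n))
    (R : Finset (Fin n) → Finset (Fin n) → Prop) :
    (lexPacket X).reverse.Pairwise R ↔ ∀ x ∈ X, ∀ y ∈ X, x < y → R (X.erase x) (X.erase y) := by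
  rw [List.pairwise_reverse, pairwise_lexPacket]

theorem nodup_lexPacket {n : ℕ} (X : Finset (Fin n)) : (lexPacket X).Nodup := by
  refine List.Nodup.map_on ?_ (List.nodup_reverse.2 (X.sort_nodup _))
  intro x hx y hy h
  simp only [List.mem_reverse, Finset.mem_sort] at hx hy
  exact Finset.erase_injOn X hx hy h

theorem card_of_mem_packet {n k : ℕ} {X S : Finset (Fin n)} (hX : X.card = k + 1)
    (hS : S ∈ packet X) : S.card = k := by
  obtain ⟨x, hx, rfl⟩ := mem_packet.1 hS
  rw [Finset.card_erase_of_mem hx, hX, Nat.add_sub_cancel]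

section Order

variable {n k : ℕ} {ρ : List (Finset (Fin n))} {X : Finset (Fin n)}

theorem IsTotalOrder.restrict_perm (h : IsTotalOrder k ρ) (hX : X.card = k + 1) :
    (restrict ρ X).Perm (lexPacket X) := by
  rw [List.perm_ext_iff_of_nodup (show (restrict ρ X).Nodup from h.1.filter _) (nodup_lexPacket X)]
  intro S
  rw [mem_lexPacket, restrict, List.mem_filter, h.2, decide_eq_true_eq]
  exact ⟨fun h => h.2, fun h => ⟨card_of_mem_packet hX h, h⟩⟩

theorem pairwise_restrict (h : IsTotalOrder k ρ) (X : Finset (Fin n)) :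
    (restrict ρ X).Pairwise fun S T => ρ.idxOf S < ρ.idxOf T :=
  (pairwise_idxOf_lt h.1).sublist List.filter_sublist

theorem restrict_eq_lexPacket_iff (h : IsTotalOrder k ρ) (hX : X.card = k + 1) :
    restrict ρ X = lexPacket X ↔
      ∀ x ∈ X, ∀ y ∈ X, x < y → ρ.idxOf (X.erase y) < ρ.idxOf (X.erase x) := by
  rw [← pairwise_lexPacket X fun S T => ρ.idxOf S < ρ.idxOf T]
  refine ⟨fun e => e ▸ pairwise_restrict h X, fun hp => ?_⟩
  exact (h.restrict_perm hX).eq_of_pairwise (fun a b _ _ h1 h2 => absurd h1 h2.asymm)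
    (pairwise_restrict h X) hp

theorem restrict_eq_reverse_lexPacket_iff (h : IsTotalOrder k ρ) (hX : X.card = k + 1) :
    restrict ρ X = (lexPacket X).reverse ↔
      ∀ x ∈ X, ∀ y ∈ X, x < y → ρ.idxOf (X.erase x) < ρ.idxOf (X.erase y) := by
  rw [← pairwise_reverse_lexPacket X fun S T => ρ.idxOf S < ρ.idxOf T]
  refine ⟨fun e => e ▸ pairwise_restrict h X, fun hp => ?_⟩
  exact ((h.restrict_perm hX).trans (List.reverse_perm _).symm).eq_of_pairwise
    (fun a b _ _ h1 h2 => absurd h1 h2.asymm) (pairwise_restrict h X) hp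

/-- Membership of `X` in the inversion set of `ρ` can be read off any two members of its packet. -/
theorem IsAdmissible.inverted_iff (h : IsAdmissible k ρ) (hX : X.card = k + 1) {x y : Fin n}
    (hx : x ∈ X) (hy : y ∈ X) (hxy : x < y) :
    restrict ρ X = (lexPacket X).reverse ↔ ρ.idxOf (X.erase x) < ρ.idxOf (X.erase y) := by
  refine ⟨fun e => (restrict_eq_reverse_lexPacket_iff h.1 hX).1 e x hx y hy hxy, fun hlt => ?_⟩
  refine (h.2 X hX).resolve_left fun e => ?_
  exact hlt.asymm ((restrict_eq_lexPacket_iff h.1 hX).1 e x hx y hy hxy)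

/-- X with both elements removed lies in both packets. -/
theorem not_disjoint_packet {S T : Finset (Fin n)} (hS : S ∈ packet X) (hT : T ∈ packet X)
    (hST : S ≠ T) : ¬ Disjoint (packet S) (packet T) := by
  obtain ⟨x, hx, rfl⟩ := mem_packet.1 hS
  obtain ⟨y, hy, rfl⟩ := mem_packet.1 hT
  have hxy : x ≠ y := by rintro rfl; exact hST rfl
  refine Finset.not_disjoint_iff.2 ⟨(X.erase x).erase y, mem_packet.2 ⟨y, ?_, rfl⟩,
    mem_packet.2 ⟨x, ?_, Finset.erase_right_comm⟩⟩
  · exact Finset.mem_erase.2 ⟨hxy.symm, hy⟩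
  · exact Finset.mem_erase.2 ⟨hxy, hx⟩

/-- The required X is the union of S and T: they differ by one exchanged element. -/
theorem exists_mem_packet {S T : Finset (Fin n)} (hS : S.card = k)
    (hST : S ≠ T) (h : ¬ Disjoint (packet S) (packet T)) :
    ∃ X : Finset (Fin n), X.card = k + 1 ∧ ∃ x ∈ X, ∃ y ∈ X, x ≠ y ∧
      S = X.erase x ∧ T = X.erase y := by
  obtain ⟨Z, hZS, hZT⟩ := Finset.not_disjoint_iff.1 h
  obtain ⟨s, hs, hsZ⟩ := mem_packet.1 hZS
  obtain ⟨t, ht, htZ⟩ := mem_packet.1 hZT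
  have hS' : S = insert s Z := by rw [← hsZ, Finset.insert_erase hs]
  have hT' : T = insert t Z := by rw [← htZ, Finset.insert_erase ht]
  have hsZ' : s ∉ Z := hsZ ▸ Finset.notMem_erase s S
  have htZ' : t ∉ Z := htZ ▸ Finset.notMem_erase t T
  have hst : s ≠ t := by rintro rfl; exact hST (hS'.trans hT'.symm)
  refine ⟨insert t S, ?_, t, by simp, s, by simp [hs], hst.symm, ?_, ?_⟩
  · rw [Finset.card_insert_of_notMem, hS]
    rw [hS']; grind
  · rw [Finset.erase_insert]
    rw [hS']; grind
  · rw [hS', hT']; grind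

/-- Distinct members of one packet have intersecting packets, so a commutation never exchanges two
of them. -/
theorem restrict_eq_of_adjSwap {ρ' : List (Finset (Fin n))} (hn : ρ.Nodup)
    (h : AdjSwap (fun S T => Disjoint (packet S) (packet T)) ρ ρ') (X : Finset (Fin n)) :
    restrict ρ' X = restrict ρ X := by
  obtain ⟨a, b, S, T, hd, rfl, rfl⟩ := h
  have hST : S ≠ T := by
    rintro rfl
    have := (List.nodup_append.1 hn).2.1
    simp at this
  have : ¬ (S ∈ packet X ∧ T ∈ packet X) := fun h => not_disjoint_packet h.1 h.2 hST hd
  simp only [restrict, List.filter_append, List.filter_cons]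
  by_cases h1 : S ∈ packet X <;> by_cases h2 : T ∈ packet X <;> simp_all

theorem IsAdmissible.adjSwap {ρ' : List (Finset (Fin n))} (hρ : IsAdmissible k ρ)
    (h : AdjSwap (fun S T => Disjoint (packet S) (packet T)) ρ ρ') : IsAdmissible k ρ' := by
  have hr := restrict_eq_of_adjSwap hρ.1.1 h
  obtain ⟨a, b, S, T, hd, rfl, rfl⟩ := h
  have hp : (a ++ T :: S :: b).Perm (a ++ S :: T :: b) := (List.Perm.swap S T b).append_left a
  refine ⟨⟨hp.nodup_iff.2 hρ.1.1, fun S => hp.mem_iff.trans (hρ.1.2 S)⟩, fun X hX => ?_⟩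
  rw [hr]
  exact hρ.2 X hX

theorem eqvGen_of_reflTransGen (ρ : AdmissibleOrder n k) {l : List (Finset (Fin n))}
    (h : Relation.ReflTransGen (AdjSwap fun S T => Disjoint (packet S) (packet T)) ρ.1 l) :
    ∃ h : IsAdmissible k l, Relation.EqvGen Commutation ρ ⟨l, h⟩ := by
  induction h with
  | refl => exact ⟨ρ.2, .refl _⟩
  | tail _ hs ih =>
    obtain ⟨h1, h2⟩ := ih
    refine ⟨h1.adjSwap hs, h2.trans _ _ _ (.rel _ _ ?_)⟩
    obtain ⟨a, b, S, T, hd, h, h'⟩ := hs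
    exact ⟨a, b, S, T, hd, h, h'⟩

/-- Commutation classes are determined by their inversion sets. -/
theorem eqvGen_commutation_iff (ρ ρ' : AdmissibleOrder n k) :
    Relation.EqvGen Commutation ρ ρ' ↔ ∀ X : Finset (Fin n), X.card = k + 1 →
      (restrict ρ.1 X = (lexPacket X).reverse ↔ restrict ρ'.1 X = (lexPacket X).reverse) := by
  constructor
  · intro h
    induction h with
    | rel ρ ρ' h =>
      intro X _
      obtain ⟨a, b, S, T, hd, h, h'⟩ := h
      rw [restrict_eq_of_adjSwap ρ.2.1.1 ⟨a, b, S, T, hd, h, h'⟩]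
    | refl => exact fun _ _ => Iff.rfl
    | symm _ _ _ ih => exact fun X hX => (ih X hX).symm
    | trans _ _ _ _ _ ih1 ih2 => exact fun X hX => (ih1 X hX).trans (ih2 X hX)
  · intro h
    obtain ⟨ρ, hρ⟩ := ρ
    obtain ⟨ρ', hρ'⟩ := ρ'
    dsimp only at h
    have hp : ρ.Perm ρ' := by
      rw [List.perm_ext_iff_of_nodup hρ.1.1 hρ'.1.1]
      exact fun S => (hρ.1.2 S).trans (hρ'.1.2 S).symm
    -- R fixes the order in ρ' of pairs with intersecting packets. Such pairs lie in a common
    -- packet, so equal inversion sets make ρ respect R too.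
    refine (eqvGen_of_reflTransGen ⟨ρ, hρ⟩ (reflTransGen_adjSwap_of_perm (R := fun S T =>
      ¬ Disjoint (packet S) (packet T) ∧ ρ'.idxOf S < ρ'.idxOf T)
      ρ' ?_ ρ hp hρ.1.1 ?_ ?_)).2
    · intro S hS T hT hST h1 h2
      by_contra hd
      have hne : ρ'.idxOf S ≠ ρ'.idxOf T := fun h => hST ((List.idxOf_inj hS).1 h)
      rcases hne.lt_or_gt with hlt | hlt
      · exact h1 ⟨hd, hlt⟩
      · exact h2 ⟨fun h' => hd h'.symm, hlt⟩
    · refine (pairwise_idxOf_lt hρ.1.1).imp_of_mem ?_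
      rintro S T hS _ hlt ⟨hd, hlt'⟩
      have hST : S ≠ T := by rintro rfl; exact lt_irrefl _ hlt
      obtain ⟨X, hX, x, hx, y, hy, hxy, rfl, rfl⟩ := exists_mem_packet ((hρ.1.2 S).1 hS)
        hST fun h' => hd h'.symm
      have hXX := h X hX
      rcases hxy.lt_or_gt with hxy | hxy
      · rw [hρ.inverted_iff hX hx hy hxy, hρ'.inverted_iff hX hx hy hxy] at hXX
        omega
      · rw [hρ.inverted_iff hX hy hx hxy, hρ'.inverted_iff hX hy hx hxy] at hXX
        omega
    · refine (pairwise_idxOf_lt hρ'.1.1).imp ?_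
      rintro S T hlt ⟨_, hlt'⟩
      exact lt_asymm hlt hlt'

end Order

/-! ### Inversion sets as graphs when k = n - 3 -/

section Graph

variable {n k : ℕ}

open Classical in
/-- The inversion set of an order on the `(n-3)`-element subsets, recorded as the graph whose edges
are the complements of the inverted `(n-2)`-element sets. -/
noncomputable def inversionGraph (ρ : List (Finset (Fin n))) (i j : ℕ) : Bool :=
  decide (∃ (hi : i < n) (hj : j < n), i < j ∧
    restrict ρ {⟨i, hi⟩, ⟨j, hj⟩}ᶜ = (lexPacket {⟨i, hi⟩, ⟨j, hj⟩}ᶜ).reverse)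

theorem inversionGraph_eq_true {ρ : List (Finset (Fin n))} {i j : ℕ} (hi : i < n) (hj : j < n)
    (hij : i < j) : inversionGraph ρ i j = true ↔
      restrict ρ {⟨i, hi⟩, ⟨j, hj⟩}ᶜ = (lexPacket {⟨i, hi⟩, ⟨j, hj⟩}ᶜ).reverse := by
  simp [inversionGraph, hi, hj, hij]

theorem card_compl_pair {a b : Fin n} (hab : a ≠ b) (hn : n = k + 3) :
    ({a, b}ᶜ : Finset (Fin n)).card = k + 1 := by
  rw [Finset.card_compl, Finset.card_pair hab, Fintype.card_fin]
  omega

theorem exists_compl_pair {X : Finset (Fin n)} (hX : X.card = k + 1) (hn : n = k + 3) :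
    ∃ a b : Fin n, a < b ∧ X = {a, b}ᶜ := by
  have h : Xᶜ.card = 2 := by
    rw [Finset.card_compl, hX, Fintype.card_fin]
    omega
  obtain ⟨a, b, hab, h⟩ := Finset.card_eq_two.1 h
  rcases hab.lt_or_gt with hab | hab
  · exact ⟨a, b, hab, by rw [← h, compl_compl]⟩
  · exact ⟨b, a, hab, by rw [Finset.pair_comm, ← h, compl_compl]⟩

/-- Along the packet of the complement of a point `i`, membership in the inversion set changes at
most once. -/
theorem IsAdmissible.inverted_row {ρ : List (Finset (Fin n))} (h : IsAdmissible k ρ)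
    (hn : n = k + 3) {i x y z : Fin n} (hx : i ≠ x) (hy : i ≠ y) (hz : i ≠ z) (hxy : x < y)
    (hyz : y < z)
    (hxz : restrict ρ {i, x}ᶜ = (lexPacket {i, x}ᶜ).reverse ↔
      restrict ρ {i, z}ᶜ = (lexPacket {i, z}ᶜ).reverse) :
    restrict ρ {i, y}ᶜ = (lexPacket {i, y}ᶜ).reverse ↔
      restrict ρ {i, x}ᶜ = (lexPacket {i, x}ᶜ).reverse := by
  -- Each of the three inversions compares two of the positions of the complements of {i,x,y},
  -- {i,x,z}, {i,y,z}; the claim is then transitivity.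
  have key : ∀ a b c : Fin n, i ≠ a → i ≠ b → i ≠ c → a ≠ b → a ≠ c → b < c →
      (restrict ρ {i, a}ᶜ = (lexPacket {i, a}ᶜ).reverse ↔
        ρ.idxOf {i, a, b}ᶜ < ρ.idxOf {i, a, c}ᶜ) := by
    intro a b c ha hb hc hab hac hbc
    have e : ∀ d : Fin n, ({i, a}ᶜ : Finset (Fin n)).erase d = {i, a, d}ᶜ := by
      intro d; ext; simp; tauto
    rw [h.inverted_iff (card_compl_pair ha hn) (x := b) (y := c) (by simp; grind) (by simp; grind)
      hbc, e, e]
  have hxz' := hxy.trans hyz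
  rw [key x y z hx hy hz hxy.ne hxz'.ne hyz, key z x y hz hx hy hxz'.ne' hyz.ne' hxy,
    Finset.pair_comm z x, Finset.pair_comm z y] at hxz
  rw [key x y z hx hy hz hxy.ne hxz'.ne hyz, key y x z hy hx hz hxy.ne' hyz.ne hxz',
    Finset.pair_comm y x]
  have hmem : ({i, y, z}ᶜ : Finset (Fin n)) ∈ ρ := by
    rw [h.1.2, Finset.card_compl, Fintype.card_fin, Finset.card_eq_three.2
      ⟨i, y, z, hy, hz, hyz.ne, rfl⟩]
    omega
  have hne : ρ.idxOf {i, y, z}ᶜ ≠ ρ.idxOf {i, x, y}ᶜ := by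
    intro h
    rw [List.idxOf_inj hmem] at h
    have := Finset.ext_iff.1 (compl_injective h) z
    simp at this
    grind
  omega

theorem IsAdmissible.inversionGraph_mem {ρ : List (Finset (Fin n))} (h : IsAdmissible k ρ)
    (hn : n = k + 3) : inversionGraph ρ ∈ consistent n := by
  refine ⟨fun i j hij => ?_, fun i j k l hij hjk hkl hl => ?_⟩
  · simp only [inversionGraph, decide_eq_true_eq] at hij
    obtain ⟨_, hj, hij, _⟩ := hij
    exact ⟨hij, hj⟩
  · have hk : k < n := by omega
    have hj : j < n := by omega
    have hi : i < n := by omega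
    have hij' : (⟨i, hi⟩ : Fin n) < ⟨j, hj⟩ := hij
    have hjk' : (⟨j, hj⟩ : Fin n) < ⟨k, hk⟩ := hjk
    have hkl' : (⟨k, hk⟩ : Fin n) < ⟨l, hl⟩ := hkl
    have hik' := hij'.trans hjk'
    have hjl' := hjk'.trans hkl'
    have hil' := hij'.trans hjl'
    simp only [Bool.eq_iff_iff, inversionGraph_eq_true hi hj hij, inversionGraph_eq_true hj hk hjk,
      inversionGraph_eq_true hk hl hkl, inversionGraph_eq_true hi hk (hij.trans hjk),
      inversionGraph_eq_true hj hl (hjk.trans hkl),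
      inversionGraph_eq_true hi hl (hij.trans (hjk.trans hkl))]
    refine ⟨h.inverted_row hn hij'.ne hik'.ne hil'.ne hjk' hkl', ?_, ?_, ?_⟩
    · have := h.inverted_row hn hij'.ne' hjk'.ne hjl'.ne hik' hkl'
      rwa [Finset.pair_comm (⟨j, hj⟩ : Fin n) ⟨i, hi⟩] at this
    · have := h.inverted_row hn hik'.ne' hjk'.ne' hkl'.ne hij' hjl'
      rwa [Finset.pair_comm (⟨k, hk⟩ : Fin n) ⟨i, hi⟩, Finset.pair_comm (⟨k, hk⟩ : Fin n) ⟨j, hj⟩] at this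
    · have := h.inverted_row hn hil'.ne' hjl'.ne' hkl'.ne' hij' hjk'
      rwa [Finset.pair_comm (⟨l, hl⟩ : Fin n) ⟨i, hi⟩, Finset.pair_comm (⟨l, hl⟩ : Fin n) ⟨j, hj⟩,
        Finset.pair_comm (⟨l, hl⟩ : Fin n) ⟨k, hk⟩] at this

theorem inversionGraph_eq_iff (hn : n = k + 3) (ρ ρ' : AdmissibleOrder n k) :
    inversionGraph ρ.1 = inversionGraph ρ'.1 ↔ Relation.EqvGen Commutation ρ ρ' := by
  rw [eqvGen_commutation_iff]
  constructor
  · intro h X hX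
    obtain ⟨a, b, hab, rfl⟩ := exists_compl_pair hX hn
    have h := congrFun (congrFun h a) b
    rwa [Bool.eq_iff_iff, inversionGraph_eq_true a.2 b.2 hab,
      inversionGraph_eq_true a.2 b.2 hab] at h
  · intro h
    funext i j
    simp only [inversionGraph, decide_eq_decide]
    refine exists_congr fun hi => exists_congr fun hj => and_congr_right fun hij => ?_
    exact h _ (card_compl_pair (Fin.ne_of_lt hij) hn)

/-- The colouring of the finite sets in which exactly the edges of `c` are coloured. -/
def IsEdge (n : ℕ) (c : ℕ → ℕ → Bool) (B : Finset (Fin n)) : Prop :=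
  ∃ i j : Fin n, i < j ∧ B = {i, j} ∧ c i j = true

theorem isEdge_pair {c : ℕ → ℕ → Bool} {i j : Fin n} (hij : i < j) :
    IsEdge n c {i, j} ↔ c i j = true := by
  refine ⟨?_, fun h => ⟨i, j, hij, rfl, h⟩⟩
  rintro ⟨a, b, hab, h, hc⟩
  have h1 := Finset.ext_iff.1 h i
  have h2 := Finset.ext_iff.1 h j
  have h3 := Finset.ext_iff.1 h a
  simp only [Finset.mem_insert, Finset.mem_singleton, true_or, or_true, true_iff, iff_true]
    at h1 h2 h3
  have : a = i ∧ b = j := by grind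
  rwa [this.1, this.2] at hc

theorem isConsistentOn_isEdge {c : ℕ → ℕ → Bool} (hc : c ∈ consistent n) :
    IsConsistentOn Finset.univ (IsEdge n c) := by
  intro A _ x _ y _ z _ hx hy hz hxy hyz
  by_cases hA : A.card = 1
  · obtain ⟨i, rfl⟩ := Finset.card_eq_one.1 hA
    rw [Finset.mem_singleton] at hx hy hz
    have hsymm : ∀ a : Fin n, insert a ({i} : Finset (Fin n)) = {i, a} := fun a =>
      Finset.pair_comm a i
    rcases lt_or_gt_of_ne hx with hx | hx
    · rcases lt_or_gt_of_ne hy with hy | hy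
      · rcases lt_or_gt_of_ne hz with hz | hz
        · rw [isEdge_pair hx, isEdge_pair hy, isEdge_pair hz]
          have := (hc.2 x y z i hxy hyz hz i.2).2.2.2
          grind
        · rw [hsymm z, isEdge_pair hx, isEdge_pair hy, isEdge_pair hz]
          have := (hc.2 x y i z hxy hy hz z.2).2.2.1
          grind
      · have hz := hy.trans hyz
        rw [hsymm z, hsymm y, isEdge_pair hx, isEdge_pair hy, isEdge_pair hz]
        have := (hc.2 x i y z hx hy hyz z.2).2.1
        grind
    · have hy := hx.trans hxy
      have hz := hy.trans hyz
      rw [hsymm x, hsymm z, hsymm y, isEdge_pair hx, isEdge_pair hy, isEdge_pair hz]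
      have := (hc.2 i x y z hx hxy hyz z.2).1
      grind
  · have hno : ∀ a, a ∉ A → ¬ IsEdge n c (insert a A) := by
      rintro a ha ⟨i, j, hij, h, _⟩
      have := congrArg Finset.card h
      rw [Finset.card_pair hij.ne, Finset.card_insert_of_notMem ha] at this
      omega
    intro _
    exact iff_of_false (hno y hy) (hno x hx)

theorem exists_inversionGraph_eq (hn : n = k + 3) (hk : 1 ≤ k) {c : ℕ → ℕ → Bool} (hc : c ∈ consistent n) :
    ∃ ρ : AdmissibleOrder n k, inversionGraph ρ.1 = c := by
  obtain ⟨f, hf⟩ := (isConsistentOn_isEdge hc).exists_rank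
  -- Complements turn `X.erase x` into `insert x Xᶜ`, the form in which f is monotone.
  let r : Finset (Fin n) → Finset (Fin n) → Prop := fun S T => f Sᶜ ≤ f Tᶜ
  have : Std.Total r := ⟨fun S T => le_total _ _⟩
  have : IsTrans _ r := ⟨fun S T U => le_trans⟩
  have : DecidableRel r := fun S T => Nat.decLe _ _
  set ρ := (Finset.univ.filter fun S : Finset (Fin n) => S.card = k).toList.insertionSort r with hρ
  have hperm := List.perm_insertionSort r
    (Finset.univ.filter fun S : Finset (Fin n) => S.card = k).toList
  rw [← hρ] at hperm
  have hsort : ρ.Pairwise r := List.pairwise_insertionSort r _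
  have htot : IsTotalOrder k ρ := by
    refine ⟨hperm.nodup_iff.2 (Finset.nodup_toList _), fun S => ?_⟩
    rw [hperm.mem_iff]
    simp
  have hlt : ∀ S T : Finset (Fin n), S.card = k → T.card = k → f Sᶜ < f Tᶜ →
      ρ.idxOf S < ρ.idxOf T := fun S T hS hT h =>
    idxOf_lt_of_pairwise (f := fun S => f Sᶜ) hsort ((htot.2 S).2 hS) ((htot.2 T).2 hT) h
  have hpos : ∀ a b : Fin n, a < b → c a b = true →
      restrict ρ {a, b}ᶜ = (lexPacket {a, b}ᶜ).reverse := by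
    intro a b hab hcab
    have hcard := card_compl_pair (k := k) hab.ne hn
    rw [restrict_eq_reverse_lexPacket_iff htot hcard]
    intro x hx y hy hxy
    refine hlt _ _ (by rw [Finset.card_erase_of_mem hx, hcard]; rfl)
      (by rw [Finset.card_erase_of_mem hy, hcard]; rfl) ?_
    rw [Finset.compl_erase, Finset.compl_erase, compl_compl]
    exact (hf {a, b} (Finset.subset_univ _) x (Finset.mem_univ _) y (Finset.mem_univ _)
      (Finset.mem_compl.1 hx) (Finset.mem_compl.1 hy) hxy).1 ((isEdge_pair hab).2 hcab)
  have hneg : ∀ a b : Fin n, a < b → c a b ≠ true → restrict ρ {a, b}ᶜ = lexPacket {a, b}ᶜ := by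
    intro a b hab hcab
    have hcard := card_compl_pair (k := k) hab.ne hn
    rw [restrict_eq_lexPacket_iff htot hcard]
    intro x hx y hy hxy
    refine hlt _ _ (by rw [Finset.card_erase_of_mem hy, hcard]; rfl)
      (by rw [Finset.card_erase_of_mem hx, hcard]; rfl) ?_
    rw [Finset.compl_erase, Finset.compl_erase, compl_compl]
    exact (hf {a, b} (Finset.subset_univ _) x (Finset.mem_univ _) y (Finset.mem_univ _)
      (Finset.mem_compl.1 hx) (Finset.mem_compl.1 hy) hxy).2 (mt (isEdge_pair hab).1 hcab)
  have hadm : IsAdmissible k ρ := by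
    refine ⟨htot, fun X hX => ?_⟩
    obtain ⟨a, b, hab, rfl⟩ := exists_compl_pair hX hn
    by_cases hcab : c a b = true
    · exact Or.inr (hpos a b hab hcab)
    · exact Or.inl (hneg a b hab hcab)
  refine ⟨⟨ρ, hadm⟩, ?_⟩
  funext i j
  by_cases hij : i < j ∧ j < n
  · obtain ⟨hij, hj⟩ := hij
    have hi := hij.trans hj
    rw [Bool.eq_iff_iff, inversionGraph_eq_true hi hj hij]
    refine ⟨fun h => ?_, hpos ⟨i, hi⟩ ⟨j, hj⟩ hij⟩
    by_contra hcij
    have h' := hneg ⟨i, hi⟩ ⟨j, hj⟩ hij hcij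
    have hcard := card_compl_pair (k := k) (a := ⟨i, hi⟩) (b := ⟨j, hj⟩) (Fin.ne_of_lt hij) hn
    -- As k ≥ 1, a packet has at least two members, so the lexicographic order differs from its
    -- reverse.
    obtain ⟨x, hx, y, hy, hxy⟩ := Finset.one_lt_card.1 (hcard ▸ (by omega : 1 < k + 1))
    rw [restrict_eq_reverse_lexPacket_iff htot hcard] at h
    rw [restrict_eq_lexPacket_iff htot hcard] at h'
    rcases hxy.lt_or_gt with hxy | hxy
    · exact lt_asymm (h x hx y hy hxy) (h' x hx y hy hxy)
    · exact lt_asymm (h y hy x hx hxy) (h' y hy x hx hxy)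
  · rw [Bool.eq_iff_iff]
    refine iff_of_false (fun h => hij ?_) fun h => hij (hc.1 i j h)
    exact (hadm.inversionGraph_mem hn).1 i j h

/-- The classes in `B(n, n-3)` correspond to the consistent graphs on `n` vertices. -/
theorem card_B_eq_ncard_consistent (hn : n = k + 3) (hk : 1 ≤ k) :
    Nat.card (B n k) = (consistent n).ncard := by
  rw [← Nat.card_coe_set_eq]
  refine Nat.card_eq_of_bijective (Quotient.lift
    (fun ρ : AdmissibleOrder n k => (⟨inversionGraph ρ.1, ρ.2.inversionGraph_mem hn⟩ : consistent n))
    fun ρ ρ' h => Subtype.ext ((inversionGraph_eq_iff hn ρ ρ').2 h)) ⟨?_, ?_⟩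
  · rintro ⟨ρ⟩ ⟨ρ'⟩ h
    exact Quotient.sound ((inversionGraph_eq_iff hn ρ ρ').1 (congrArg Subtype.val h))
  · rintro ⟨c, hc⟩
    obtain ⟨ρ, h⟩ := exists_inversionGraph_eq hn hk hc
    exact ⟨Quotient.mk _ ρ, Subtype.ext h⟩

end Graph

end HigherBruhat

theorem theorem7p3 (n : ℕ) (hn : 4 ≤ n) :
    (Nat.card (HigherBruhat.B n (n - 3)) : ℤ) = 2 ^ n + n * 2 ^ (n - 2) - 2 * n := by
  obtain ⟨k, rfl⟩ : ∃ k, n = k + 3 := ⟨n - 3, by omega⟩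
  rw [HigherBruhat.card_B_eq_ncard_consistent (by omega) (by omega), HigherBruhat.ncard_consistent]
  push_cast
  rfl
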